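/- Fix a horizon $T>0$, a capacity $C\in\mathbb{N}$, nonnegative integrable rate functions $\lambda,\mu$ on $[0,T]$, constants $K_1,K_2,K_3>0$ and a temperature $\gamma\ge 0$. Potential customers arrive at a single-server queue according to a non-homogeneous Poisson process with rate $\lambda(t)$, and (potential) service completions follow an independent non-homogeneous Poisson process with rate $\mu(t)$. A randomized Markov policy $\boldsymbol\pi$ assigns to each $(t,x)\in[0,T]\times\mathcal X$, $\mathcal X=\{0,\dots,C\}$, a Bernoulli distribution $\boldsymbol\pi(\cdot\mid t,x)$ on the action set $\{0,1\}$ ($0$ = reject, $1$ = admit), with $t\mapsto\boldsymbol\pi(1\mid t,x)$ measurable for each $x$. At each arrival time $\tau$ an action is sampled from $\boldsymbol\pi(\cdot\mid\tau,X_{\tau-}^{\boldsymbol\pi})$, using one of a sequence of i.i.d. uniform variables that is independent of the two Poisson processes; the customer enters the system iff the action is $1$ and $X_{\tau-}^{\boldsymbol\pi}<C$. At each time of the service process a customer departs iff the system is not empty. The system is initially empty. Let $A_t^{\boldsymbol\pi}$ and $D_t^{\boldsymbol\pi}$ be the numbers of admitted customers and of departures up to time $t$, and let $X_t^{\boldsymbol\pi}=A_t^{\boldsymbol\pi}-D_t^{\boldsymbol\pi}$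 be the queue length. With the entropy $\mathcal H(\boldsymbol\pi(\cdot\mid t,x))=-\sum_{a\in\{0,1\}}\boldsymbol\pi(a\mid t,x)\log\boldsymbol\pi(a\mid t,x)$ put $$G_t = K_1\int_{(t,T]}dA_s^{\boldsymbol\pi}-K_2\int_t^T X_{s-}^{\boldsymbol\pi}\,ds-K_3X_T^{\boldsymbol\pi}+\gamma\int_t^T\mathcal H(\boldsymbol\pi(\cdot\mid s,X_{s-}^{\boldsymbol\pi}))\,ds,\qquad J(t,x;\boldsymbol\pi)=\mathbb E\left[G_t\mid X_t^{\boldsymbol\pi}=x\right]$$ (the value of $J$ at pairs $(t,x)$ with $\mathbb P(X_t^{\boldsymbol\pi}=x)=0$ is immaterial below). Let $\{J^\theta:\theta\in\Theta\}$ be any family of functions $J^\theta:[0,T]\times\mathcal X\to\mathbb R$ that are measurable in $t$, and define, with values in $[0,\infty]$, $$L(\theta)=\frac12\,\mathbb E\left[\int_0^T\big(G_t-J^\theta(t,X_t^{\boldsymbol\pi})\big)^2dt\right],\qquad \operatorname{MSVE}(\theta)=\frac12\,\mathbb E\left[\int_0^T\big|J(t,X_t^{\boldsymbol\pi};\boldsymbol\pi)-J^\theta(t,X_t^{\boldsymbol\pi})\big|^2dt\right].$$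 **Theorem.** $\displaystyle\operatorname*{arg\,min}_{\theta\in\Theta}L(\theta)=\operatorname*{arg\,min}_{\theta\in\Theta}\operatorname{MSVE}(\theta)$. -/

import Mathlib

open MeasureTheory ProbabilityTheory

noncomputable section

/-- Data of the admission control problem: horizon `T`, capacity `C`, arrival rate `lam`, service
rate `mu`, admission reward `K₁`, holding cost `K₂`, terminal penalty `K₃`, temperature `γ`. -/
structure AdmissionQueue where
  T : ℝ
  C : ℕ
  lam : ℝ → ℝ
  mu : ℝ → ℝ
  K₁ : ℝ
  K₂ : ℝ
  K₃ : ℝ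
  γ : ℝ
  T_pos : 0 < T
  lam_nonneg : ∀ t ∈ Set.Icc 0 T, 0 ≤ lam t
  lam_integrable : IntervalIntegrable lam volume 0 T
  mu_nonneg : ∀ t ∈ Set.Icc 0 T, 0 ≤ mu t
  mu_integrable : IntervalIntegrable mu volume 0 T
  K₁_pos : 0 < K₁
  K₂_pos : 0 < K₂
  K₃_pos : 0 < K₃
  γ_nonneg : 0 ≤ γ

/-- A non-homogeneous Poisson (counting) process on `[0, T]` with the given rate function: it starts
at `0`, has nondecreasing right-continuous integer-valued paths, independent increments, and the
increment over `(s, t]` has the Poisson law with mean `∫ u in s..t, rate u`. -/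
structure IsPoissonProcessOn {Ω : Type*} [MeasurableSpace Ω] (T : ℝ) (rate : ℝ → ℝ)
    (N : ℝ → Ω → ℕ) (P : Measure Ω) : Prop where
  measurable : ∀ t ∈ Set.Icc 0 T, Measurable (N t)
  zero : ∀ ω, N 0 ω = 0
  mono : ∀ ω, MonotoneOn (fun t => N t ω) (Set.Icc 0 T)
  right_cont : ∀ ω, ∀ t ∈ Set.Ico 0 T, ContinuousWithinAt (fun s => N s ω) (Set.Ioi t) t
  indep : HasIndepIncrements (fun (t : Set.Icc (0 : ℝ) T) ω => N t ω) P
  law : ∀ s t, 0 ≤ s → s ≤ t → t ≤ T →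
    P.map (fun ω => N t ω - N s ω) = poissonMeasure (∫ u in s..t, rate u).toNNReal

/-- The time of the `k`-th jump (`k = 0, 1, …`) in `[0, T]` of a counting path `n`;
it is `⊤` if there is no such jump. -/
def eventTime (T : ℝ) (n : ℝ → ℕ) (k : ℕ) : EReal :=
  sInf ((fun t : ℝ => (t : EReal)) '' {t : ℝ | t ∈ Set.Icc 0 T ∧ k < n t})

/-- Bookkeeping of the queue after finitely many events: number of arrivals and of service events
processed so far, queue length, number of admitted customers, number of departed customers. -/
structure QueueRecord (C : ℕ) where
  arr : ℕ
  srv : ℕ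
  len : Fin (C + 1)
  adm : ℕ
  dep : ℕ

namespace AdmissionQueue

/-- The state space `{0, …, C}`. -/
abbrev State (Q : AdmissionQueue) : Type := Fin (Q.C + 1)

/-- A randomized Markov policy: `prob t x` is the probability of action `1` (admit) at `(t, x)`,
that is, the policy takes `(t, x)` to the Bernoulli law with success probability `prob t x`. -/
structure Policy (Q : AdmissionQueue) where
  prob : ℝ → Q.State → ℝ
  prob_mem : ∀ t ∈ Set.Icc 0 Q.T, ∀ x, prob t x ∈ Set.Icc (0 : ℝ) 1
  measurable : ∀ x, Measurable fun t : Set.Icc (0 : ℝ) Q.T => prob t x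

/-- The sources of randomness: the process `arrivals` of all potential customers, the process
`services` of potential service completions, and the variables `mark k` used to sample the action
at the `k`-th arrival. -/
structure Noise (Ω : Type*) where
  arrivals : ℝ → Ω → ℕ
  services : ℝ → Ω → ℕ
  mark : ℕ → Ω → ℝ

/-- The arrivals and the services are Poisson processes with rates `lam` and `mu`, the marks are
i.i.d. uniform on `[0, 1]`, and the three are independent. -/
structure IsDriving (Q : AdmissionQueue) {Ω : Type*} [MeasurableSpace Ω] (W : Noise Ω)
    (P : Measure Ω) : Prop where
  arrivals : IsPoissonProcessOn Q.T Q.lam W.arrivals P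
  services : IsPoissonProcessOn Q.T Q.mu W.services P
  mark_measurable : ∀ k, Measurable (W.mark k)
  mark_law : ∀ k, P.map (W.mark k) = volume.restrict (Set.Icc 0 1)
  mark_indep : iIndepFun W.mark P
  indep_services : IndepFun (fun ω (t : Set.Icc (0 : ℝ) Q.T) => W.arrivals t ω)
    (fun ω (t : Set.Icc (0 : ℝ) Q.T) => W.services t ω) P
  indep_mark : IndepFun
    (fun ω => ((fun t : Set.Icc (0 : ℝ) Q.T => W.arrivals t ω),
      (fun t : Set.Icc (0 : ℝ) Q.T => W.services t ω)))
    (fun ω k => W.mark k ω) P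

variable (Q : AdmissionQueue)

/-- An arrival at time `τ` whose mark is `u`: the action drawn from `π (· | τ, x)` is "admit" iff
`u < π (1 | τ, x)`, where `x` is the queue length before the arrival; an admitted customer
enters the system if it is not full. -/
def arrive (π : Q.Policy) (τ u : ℝ) (r : QueueRecord Q.C) : QueueRecord Q.C :=
  open Classical in
  if h : (r.len : ℕ) < Q.C ∧ u < π.prob τ r.len then
    { arr := r.arr + 1, srv := r.srv, len := ⟨r.len + 1, by omega⟩, adm := r.adm + 1, dep := r.dep }
  else
    { r with arr := r.arr + 1 }

/-- A service event: a customer departs if the system is not empty. -/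
def serve (r : QueueRecord Q.C) : QueueRecord Q.C :=
  if 0 < (r.len : ℕ) then
    { arr := r.arr, srv := r.srv + 1, len := ⟨r.len - 1, by omega⟩, adm := r.adm, dep := r.dep + 1 }
  else
    { r with srv := r.srv + 1 }

variable {Ω : Type*}

/-- The queue, initially empty, after the first `n` events (arrivals and service events merged in
the order of time). -/
def record (π : Q.Policy) (W : Noise Ω) (ω : Ω) : ℕ → QueueRecord Q.C
  | 0 => { arr := 0, srv := 0, len := 0, adm := 0, dep := 0 }
  | n + 1 =>
    open Classical in
    let r := record π W ω n
    let τ := eventTime Q.T (fun t => W.arrivals t ω) r.arr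
    let σ := eventTime Q.T (fun t => W.services t ω) r.srv
    if τ ≤ σ then Q.arrive π τ.toReal (W.mark r.arr ω) r else Q.serve r

/-- The queue at time `t ∈ [0, T]`: all events in `[0, t]` have been processed. -/
def recordAt (π : Q.Policy) (W : Noise Ω) (t : ℝ) (ω : Ω) : QueueRecord Q.C :=
  Q.record π W ω (W.arrivals t ω + W.services t ω)

/-- The queue length `X_t`. -/
def X (π : Q.Policy) (W : Noise Ω) (t : ℝ) (ω : Ω) : Q.State := (Q.recordAt π W t ω).len

/-- The admitted arrival process `A_t`. -/
def A (π : Q.Policy) (W : Noise Ω) (t : ℝ) (ω : Ω) : ℕ := (Q.recordAt π W t ω).adm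

/-- The departure process `D_t`. -/
def D (π : Q.Policy) (W : Noise Ω) (t : ℝ) (ω : Ω) : ℕ := (Q.recordAt π W t ω).dep

theorem record_adm (π : Q.Policy) (W : Noise Ω) (ω : Ω) (n : ℕ) :
    (Q.record π W ω n).adm = (Q.record π W ω n).len + (Q.record π W ω n).dep := by
  induction n with
  | zero => simp [record]
  | succ n ih =>
    simp only [record, arrive, serve]
    split_ifs <;> simp_all <;> omega

/-- The queue length is `X_t = A_t - D_t`. -/
theorem X_eq (π : Q.Policy) (W : Noise Ω) (t : ℝ) (ω : Ω) :
    ((Q.X π W t ω : ℕ) : ℤ) = (Q.A π W t ω : ℤ) - (Q.D π W t ω : ℤ) := by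
  have h := Q.record_adm π W ω (W.arrivals t ω + W.services t ω)
  simp only [X, A, D, recordAt]
  omega

/-- The left limit `X_{t-}`. -/
def XLeft (π : Q.Policy) (W : Noise Ω) (t : ℝ) (ω : Ω) : Q.State :=
  Function.leftLim (fun s => Q.X π W s ω) t

/-- The entropy of the Bernoulli law `π (· | t, x)`. -/
def entropy (π : Q.Policy) (t : ℝ) (x : Q.State) : ℝ := Real.binEntropy (π.prob t x)

/-- The realized entropy-regularized reward over `(t, T]`; the integral of the constant `K₁`
against `dA` over `(t, T]` is `K₁ * (A_T - A_t)`. -/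
def rewardToGo (π : Q.Policy) (W : Noise Ω) (t : ℝ) (ω : Ω) : ℝ :=
  Q.K₁ * ((Q.A π W Q.T ω : ℝ) - (Q.A π W t ω : ℝ))
    - Q.K₂ * (∫ s in t..Q.T, ((Q.XLeft π W s ω : ℕ) : ℝ))
    - Q.K₃ * ((Q.X π W Q.T ω : ℕ) : ℝ)
    + Q.γ * (∫ s in t..Q.T, Q.entropy π s (Q.XLeft π W s ω))

variable [MeasurableSpace Ω]

/-- The value function `J (t, x; π)`: the expected reward-to-go given `X_t = x`. (If `X_t = x` has
probability `0`, the conditional expectation is undetermined and takes the value `0` here.) -/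
def J (P : Measure Ω) (π : Q.Policy) (W : Noise Ω) (t : ℝ) (x : Q.State) : ℝ :=
  ∫ ω, Q.rewardToGo π W t ω ∂(cond P {ω | Q.X π W t ω = x})

/-- The Monte Carlo loss of an approximate value function `v`, with values in `[0, ∞]`. -/
def mcLoss (P : Measure Ω) (π : Q.Policy) (W : Noise Ω) (v : ℝ → Q.State → ℝ) : ENNReal :=
  2⁻¹ * ∫⁻ ω, (∫⁻ t in Set.Icc 0 Q.T,
    ENNReal.ofReal ((Q.rewardToGo π W t ω - v t (Q.X π W t ω)) ^ 2)) ∂P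

/-- The mean-squared value error of an approximate value function `v`, with values in `[0, ∞]`. -/
def msve (P : Measure Ω) (π : Q.Policy) (W : Noise Ω) (v : ℝ → Q.State → ℝ) : ENNReal :=
  2⁻¹ * ∫⁻ ω, (∫⁻ t in Set.Icc 0 Q.T,
    ENNReal.ofReal (|Q.J P π W t (Q.X π W t ω) - v t (Q.X π W t ω)| ^ 2)) ∂P

end AdmissionQueue

/-- The set of minimizers of `f`. -/
def argminSet {Θ : Type*} (f : Θ → ENNReal) : Set Θ := {θ | ∀ θ', f θ ≤ f θ'}

end

/-!
The Monte Carlo loss and the mean-squared value error differ by a finite constant, so they have the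
same minimizers.

At a fixed time `t` the value `J (t, X_t)` is the conditional mean of the reward-to-go `G_t` given
`X_t`, hence `G_t - J (t, X_t)` is orthogonal in `L²` to every function of `X_t`
(`integral_sub_cond_mul_eq_zero`), and Pythagoras gives
`E (G_t - v (t, X_t))² = E (G_t - J (t, X_t))² + E (J (t, X_t) - v (t, X_t))²`
(`lintegral_ofReal_sq_eq_add`). Integrating over `t` with Tonelli's theorem yields
`mcLoss = residualLoss + msve` in `[0, ∞]`, where `residualLoss` does not depend on `v`
(`mcLoss_eq_residualLoss_add_msve`). It can be cancelled because it is finite: `|G_t|` is bounded by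
an affine function of the total number of Poisson events, which has a finite second moment
(`abs_rewardToGo_le`, `residualLoss_ne_top`).

Tonelli's theorem needs all processes to be measurable jointly in time and randomness. Right
continuity makes `eventTime ≤ t` equivalent to the counting path having passed level `k` by time
`t`, so event times are measurable and counting processes are jointly measurable. The queue is a
countable-state recursion driven by the event times and the marks; its left limits are pointwise
limits of the queue along times increasing to `t`, and the reward-to-go is a parametric integral.
Functions of time are only controlled on `[0, T]`, which is why the time variable ranges over the
subtype `Set.Icc 0 T`.
-/

open MeasureTheory ProbabilityTheory Filter Topology
open scoped ENNReal

/-! ### Orthogonality of the conditional expectation -/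

section Orthogonality

variable {Ω S : Type*} [MeasurableSpace Ω] {P : Measure Ω}

/-- Multiplying the average over `s` by the mass of `s` gives the integral over `s`, also when `s`
is a null set, where the conditioned measure vanishes. -/
theorem measureReal_mul_integral_cond [IsFiniteMeasure P] (s : Set Ω) (G : Ω → ℝ) :
    P.real s * ∫ ω, G ω ∂(cond P s) = ∫ ω in s, G ω ∂P := by
  rw [ProbabilityTheory.cond, integral_smul_measure, smul_eq_mul, ENNReal.toReal_inv,
    ← mul_assoc, ← measureReal_def]
  rcases eq_or_ne (P.real s) 0 with h | h
  · have h0 : P s = 0 := (measureReal_eq_zero_iff).1 h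
    simp [h, Measure.restrict_eq_zero.2 h0]
  · rw [mul_inv_cancel₀ h, one_mul]

variable [Fintype S] [MeasurableSpace S] [MeasurableSingletonClass S] {X : Ω → S} {G : Ω → ℝ}

theorem memLp_two_comp_of_finite [IsFiniteMeasure P] (hX : Measurable X) (w : S → ℝ) :
    MemLp (fun ω => w (X ω)) 2 P := by
  refine MemLp.of_bound ((measurable_of_finite w).comp hX).aestronglyMeasurable
    (∑ x, ‖w x‖) (ae_of_all _ fun ω => ?_)
  exact Finset.single_le_sum (f := fun x => ‖w x‖) (fun x _ => norm_nonneg _) (Finset.mem_univ _)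

/-- The deviation of `G` from its conditional mean given `X` is orthogonal to the functions of
`X`. -/
theorem integral_sub_cond_mul_eq_zero [IsFiniteMeasure P] (hX : Measurable X)
    (hG : Integrable G P) (h : S → ℝ) :
    ∫ ω, (G ω - ∫ ω', G ω' ∂(cond P {ω' | X ω' = X ω})) * h (X ω) ∂P = (0 : ℝ) := by
  classical
  have hms : ∀ x, MeasurableSet {ω | X ω = x} := fun x => hX (measurableSet_singleton x)
  have key : ∀ ω, (G ω - ∫ ω', G ω' ∂(cond P {ω' | X ω' = X ω})) * h (X ω)
      = ∑ x, {ω | X ω = x}.indicator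
        (fun ω => (G ω - ∫ ω', G ω' ∂(cond P {ω' | X ω' = x})) * h x) ω := by
    intro ω
    rw [Finset.sum_eq_single (X ω)]
    · simp
    · intro x _ hx
      exact Set.indicator_of_notMem (s := {ω | X ω = x}) (fun h' => hx (Eq.symm h')) _
    · simp
  have hi : ∀ x, Integrable
      (fun ω => (G ω - ∫ ω', G ω' ∂(cond P {ω' | X ω' = x})) * h x) P :=
    fun x => (hG.sub (integrable_const _)).mul_const _
  simp_rw [key]
  rw [integral_finsetSum _ fun x _ => (hi x).indicator (hms x)]
  refine Finset.sum_eq_zero fun x _ => ?_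
  rw [integral_indicator (hms x), integral_mul_const,
    integral_sub hG.integrableOn (integrable_const _), setIntegral_const, smul_eq_mul,
    measureReal_mul_integral_cond, sub_self, zero_mul]

/-- Pythagoras for the projection of `G` onto the functions of `X`, in `[0, ∞]`. -/
theorem lintegral_ofReal_sq_eq_add [IsFiniteMeasure P] (hX : Measurable X)
    (hG : MemLp G 2 P) (w : S → ℝ) :
    ∫⁻ ω, ENNReal.ofReal ((G ω - w (X ω)) ^ 2) ∂P
      = ∫⁻ ω, ENNReal.ofReal ((G ω - ∫ ω', G ω' ∂(cond P {ω' | X ω' = X ω})) ^ 2) ∂P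
        + ∫⁻ ω, ENNReal.ofReal
            (|(∫ ω', G ω' ∂(cond P {ω' | X ω' = X ω})) - w (X ω)| ^ 2) ∂P := by
  set m : S → ℝ := fun x => ∫ ω', G ω' ∂(cond P {ω' | X ω' = x}) with hm
  have hmL : MemLp (fun ω => m (X ω)) 2 P := memLp_two_comp_of_finite hX m
  have hwL : MemLp (fun ω => w (X ω)) 2 P := memLp_two_comp_of_finite hX w
  have h0 := (hG.sub hwL).integrable_sq
  have h1 := (hG.sub hmL).integrable_sq
  have h2 := (hmL.sub hwL).integrable_sq
  have h3 : Integrable (fun ω => 2 * ((G ω - m (X ω)) * (m (X ω) - w (X ω)))) P :=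
    ((hG.sub hmL).integrable_mul (hmL.sub hwL)).const_mul 2
  have hc : ∫ ω, (G ω - m (X ω)) * (m (X ω) - w (X ω)) ∂P = 0 :=
    integral_sub_cond_mul_eq_zero hX (hG.integrable one_le_two) (fun x => m x - w x)
  simp only [sq_abs]
  simp only [Pi.sub_apply] at h0 h1 h2
  change _ = ∫⁻ ω, ENNReal.ofReal ((G ω - m (X ω)) ^ 2) ∂P
    + ∫⁻ ω, ENNReal.ofReal ((m (X ω) - w (X ω)) ^ 2) ∂P
  rw [← ofReal_integral_eq_lintegral_ofReal h0 (ae_of_all _ fun ω => sq_nonneg _),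
    ← ofReal_integral_eq_lintegral_ofReal h1 (ae_of_all _ fun ω => sq_nonneg _),
    ← ofReal_integral_eq_lintegral_ofReal h2 (ae_of_all _ fun ω => sq_nonneg _),
    ← ENNReal.ofReal_add (integral_nonneg fun _ => sq_nonneg _)
      (integral_nonneg fun _ => sq_nonneg _)]
  congr 1
  have hexp : ∀ ω, (G ω - w (X ω)) ^ 2 = ((G ω - m (X ω)) ^ 2 + (m (X ω) - w (X ω)) ^ 2)
      + 2 * ((G ω - m (X ω)) * (m (X ω) - w (X ω))) := fun ω => by ring
  simp_rw [hexp]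
  rw [integral_add (by exact h1.add h2) h3, integral_add h1 h2, integral_const_mul, hc, mul_zero,
    add_zero]

end Orthogonality

/-! ### Counting processes and their event times -/

section Counting

theorem memLp_two_natCast_poissonMeasure (r : NNReal) :
    MemLp (fun n : ℕ => (n : ℝ)) 2 (poissonMeasure r) := by
  rw [memLp_two_iff_integrable_sq (by fun_prop), integrable_poissonMeasure_iff]
  -- `n ^ 2 ≤ 4 ^ n` bounds the second moment by an exponential series.
  refine Summable.of_nonneg_of_le (fun n => by positivity) (fun n => ?_)
    ((Real.summable_pow_div_factorial (4 * (r : ℝ))).mul_left (Real.exp (-r)))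
  have h : ((n : ℝ)) ^ 2 ≤ 4 ^ n := by
    have h1 : (n : ℝ) ≤ 2 ^ n := by exact_mod_cast Nat.lt_two_pow_self.le
    calc (n : ℝ) ^ 2 ≤ (2 ^ n) ^ 2 := by gcongr
      _ = 4 ^ n := by rw [← pow_mul, mul_comm, pow_mul]; norm_num
  rw [Real.norm_of_nonneg (by positivity), mul_pow]
  calc Real.exp (-r) * (r : ℝ) ^ n / n.factorial * (n : ℝ) ^ 2
      ≤ Real.exp (-r) * (r : ℝ) ^ n / n.factorial * 4 ^ n := by gcongr
    _ = _ := by ring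

variable {T : ℝ} {n : ℝ → ℕ}

/-- The infimum that defines the event time is attained, by right continuity. -/
theorem eventTime_le_coe_iff (hn : MonotoneOn n (Set.Icc 0 T))
    (hrc : ∀ t ∈ Set.Ico 0 T, ContinuousWithinAt n (Set.Ioi t) t) {t : ℝ}
    (ht : t ∈ Set.Icc 0 T) (k : ℕ) : eventTime T n k ≤ t ↔ k < n t := by
  refine ⟨fun h => ?_, fun h => sInf_le ⟨t, ⟨ht, h⟩, rfl⟩⟩
  by_contra! hk
  have hlt : ∀ s ∈ Set.Icc 0 T, k < n s → t < s := fun s hs hks => by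
    by_contra! hst
    exact absurd (hn hs ht hst) (by omega)
  rcases ht.2.lt_or_eq with htT | rfl
  · have hev : ∀ᶠ s in 𝓝[>] t, n s = n t := by
      have h' := (hrc t ⟨ht.1, htT⟩).tendsto
      rw [nhds_discrete] at h'
      exact tendsto_pure.1 h'
    obtain ⟨u, hu, hus⟩ := mem_nhdsGT_iff_exists_Ioo_subset.1 hev
    have : (u : EReal) ≤ eventTime T n k := by
      refine le_sInf ?_
      rintro _ ⟨s, ⟨hs, hks⟩, rfl⟩
      by_contra! hsu
      have := hus ⟨hlt s hs hks, EReal.coe_lt_coe_iff.1 hsu⟩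
      simp only [Set.mem_ofPred_eq] at this
      omega
    exact absurd (EReal.coe_le_coe_iff.1 (this.trans h)) (not_le.2 hu)
  · have : eventTime t n k = ⊤ := by
      refine sInf_eq_top.2 ?_
      rintro _ ⟨s, ⟨hs, hks⟩, rfl⟩
      exact absurd hs.2 (not_le.2 (hlt s hs hks))
    rw [this] at h
    exact absurd h (by simp)

theorem eventTime_nonneg (T : ℝ) (n : ℝ → ℕ) (k : ℕ) : 0 ≤ eventTime T n k := by
  refine le_sInf ?_
  rintro _ ⟨s, ⟨hs, -⟩, rfl⟩
  exact EReal.coe_nonneg.2 hs.1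

theorem eventTime_le_of_ne_top {k : ℕ} (h : eventTime T n k ≠ ⊤) : eventTime T n k ≤ T := by
  by_contra! hT
  refine h (sInf_eq_top.2 ?_)
  rintro _ ⟨s, ⟨hs, hks⟩, rfl⟩
  have h1 : eventTime T n k ≤ s := sInf_le ⟨s, ⟨hs, hks⟩, rfl⟩
  exact absurd (EReal.coe_lt_coe_iff.1 (hT.trans_le h1)) (not_lt.2 hs.2)

/-- A missing event has time `⊤`, whose real value `0` also lies in `[0, T]`. -/
theorem eventTime_toReal_mem (hT : 0 ≤ T) (n : ℝ → ℕ) (k : ℕ) :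
    (eventTime T n k).toReal ∈ Set.Icc 0 T := by
  refine ⟨EReal.toReal_nonneg (eventTime_nonneg T n k), ?_⟩
  by_cases h : eventTime T n k = ⊤
  · simpa [h] using hT
  · exact EReal.toReal_le_toReal (eventTime_le_of_ne_top h)
      (ne_bot_of_le_ne_bot EReal.zero_ne_bot (eventTime_nonneg T n k)) (EReal.coe_ne_top T)

/-- An integer-valued monotone path is constant just before `t`: it attains its supremum over
`[0, t)`. -/
theorem MonotoneOn.exists_eventually_eq_nhdsLT (hn : MonotoneOn n (Set.Icc 0 T)) {t : ℝ}
    (ht0 : 0 < t) (htT : t ≤ T) : ∃ m, ∀ᶠ s in 𝓝[<] t, n s = m := by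
  have hb : BddAbove (n '' Set.Ico 0 t) := by
    refine ⟨n t, ?_⟩
    rintro _ ⟨s, hs, rfl⟩
    exact hn ⟨hs.1, hs.2.le.trans htT⟩ ⟨ht0.le, htT⟩ hs.2.le
  obtain ⟨s₀, hs₀, hmax⟩ :=
    Nat.sSup_mem (s := n '' Set.Ico 0 t) ⟨n 0, 0, ⟨le_rfl, ht0⟩, rfl⟩ hb
  refine ⟨n s₀, ?_⟩
  filter_upwards [Ioo_mem_nhdsLT hs₀.2] with s hs
  have hs' : s ∈ Set.Ico 0 t := ⟨hs₀.1.trans hs.1.le, hs.2⟩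
  refine le_antisymm ?_ (hn ⟨hs₀.1, hs₀.2.le.trans htT⟩ ⟨hs'.1, hs.2.le.trans htT⟩ hs.1.le)
  rw [hmax]
  exact le_csSup hb ⟨s, hs', rfl⟩

variable {Ω : Type*} [MeasurableSpace Ω] {P : Measure Ω} {rate : ℝ → ℝ} {N : ℝ → Ω → ℕ}

namespace IsPoissonProcessOn

theorem measurable_eventTime (hN : IsPoissonProcessOn T rate N P) (k : ℕ) :
    Measurable fun ω => eventTime T (fun t => N t ω) k := by
  refine measurable_of_Iic fun a => ?_
  have hset : ∀ t ∈ Set.Icc 0 T, MeasurableSet {ω | eventTime T (fun t => N t ω) k ≤ t} := by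
    intro t ht
    simp_rw [eventTime_le_coe_iff (hN.mono _) (hN.right_cont _) ht]
    exact measurableSet_lt measurable_const (hN.measurable t ht)
  change MeasurableSet {ω | eventTime T (fun t => N t ω) k ≤ a}
  rcases lt_or_ge a 0 with ha0 | ha0
  · convert MeasurableSet.empty
    rw [Set.eq_empty_iff_forall_notMem]
    exact fun ω hω => absurd (hω.trans_lt ha0) (not_lt.2 (eventTime_nonneg _ _ _))
  rcases eq_or_ne a ⊤ with rfl | hat
  · simp
  lift a to ℝ using ⟨hat, ne_bot_of_le_ne_bot EReal.zero_ne_bot ha0⟩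
  have ha0' : 0 ≤ a := by exact_mod_cast ha0
  rcases le_or_gt a T with haT | haT
  · exact hset a ⟨ha0', haT⟩
  rcases lt_or_ge T 0 with hT | hT
  · convert MeasurableSet.empty
    rw [Set.eq_empty_iff_forall_notMem]
    intro ω hω
    have h1 := eventTime_le_of_ne_top (ne_top_of_le_ne_top (EReal.coe_ne_top a) hω)
    have h2 := EReal.coe_le_coe_iff.1 ((eventTime_nonneg T (fun t => N t ω) k).trans h1)
    exact absurd h2 (not_le.2 hT)
  · convert hset T ⟨hT, le_rfl⟩ using 3 with ω
    refine ⟨fun h => eventTime_le_of_ne_top (ne_top_of_le_ne_top (EReal.coe_ne_top a) h),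
      fun h => h.trans (EReal.coe_le_coe_iff.2 haT.le)⟩

/-- A counting process is jointly measurable, since its level sets are described by the event
times. -/
theorem measurable_uncurry (hN : IsPoissonProcessOn T rate N P) :
    Measurable fun p : Set.Icc 0 T × Ω => N p.1 p.2 := by
  refine measurable_of_Ioi fun k => ?_
  have : (fun p : Set.Icc 0 T × Ω => N p.1 p.2) ⁻¹' Set.Ioi k
      = {p | eventTime T (fun t => N t p.2) k ≤ ((p.1 : ℝ) : EReal)} := by
    ext p
    exact (eventTime_le_coe_iff (hN.mono _) (hN.right_cont _) p.1.2 k).symm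
  rw [this]
  exact measurableSet_le ((hN.measurable_eventTime k).comp measurable_snd)
    (measurable_coe_real_ereal.comp (measurable_subtype_coe.comp measurable_fst))

theorem memLp_two (hN : IsPoissonProcessOn T rate N P) (hT : 0 ≤ T) :
    MemLp (fun ω => (N T ω : ℝ)) 2 P := by
  have hlaw := hN.law 0 T le_rfl hT le_rfl
  simp only [hN.zero, tsub_zero] at hlaw
  have h := memLp_two_natCast_poissonMeasure (∫ u in (0 : ℝ)..T, rate u).toNNReal
  rw [← hlaw, memLp_map_measure_iff (by fun_prop)
    (hN.measurable T ⟨hT, le_rfl⟩).aemeasurable] at h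
  exact h

end IsPoissonProcessOn

end Counting

/-! ### Measurability of the queue -/

/-- Records form a countable set and carry the discrete σ-algebra. -/
instance (C : ℕ) : MeasurableSpace (QueueRecord C) := ⊤

instance (C : ℕ) : DiscreteMeasurableSpace (QueueRecord C) := ⟨fun _ => trivial⟩

instance (C : ℕ) : Countable (QueueRecord C) :=
  Function.Injective.countable
    (f := fun r : QueueRecord C => (r.arr, r.srv, r.len, r.adm, r.dep))
    (by rintro ⟨⟩ ⟨⟩ h; simpa using h)

namespace AdmissionQueue

variable (Q : AdmissionQueue) (π : Q.Policy) {Ω : Type*} (W : Noise Ω)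

theorem record_adm_le (ω : Ω) (n : ℕ) : (Q.record π W ω n).adm ≤ n := by
  induction n with
  | zero => simp [record]
  | succ n ih =>
    simp only [record, arrive, serve]
    split_ifs <;> simp_all <;> omega

variable [MeasurableSpace Ω] {Q W} {P : Measure Ω}

theorem IsDriving.measurable_record (hW : Q.IsDriving W P) (n : ℕ) :
    Measurable fun ω => Q.record π W ω n := by
  classical
  induction n with
  | zero => exact measurable_const
  | succ n ih =>
    let step : QueueRecord Q.C × Ω → QueueRecord Q.C := fun p =>
      if eventTime Q.T (fun t => W.arrivals t p.2) p.1.arr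
          ≤ eventTime Q.T (fun t => W.services t p.2) p.1.srv then
        Q.arrive π (eventTime Q.T (fun t => W.arrivals t p.2) p.1.arr).toReal
          (W.mark p.1.arr p.2) p.1
      else Q.serve p.1
    have hstep : Measurable step := by
      refine measurable_from_prod_countable_right fun r => ?_
      have hτ := hW.arrivals.measurable_eventTime r.arr
      refine Measurable.ite (measurableSet_le hτ (hW.services.measurable_eventTime r.srv)) ?_
        (measurable_const (a := Q.serve r))
      have hτI : Measurable fun ω => (⟨_, eventTime_toReal_mem Q.T_pos.le
          (fun t => W.arrivals t ω) r.arr⟩ : Set.Icc 0 Q.T) :=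
        (measurable_ereal_toReal.comp hτ).subtype_mk
      have hprob := (π.measurable r.len).comp hτI
      by_cases hC : (r.len : ℕ) < Q.C
      · have : ∀ τ u, Q.arrive π τ u r = if u < π.prob τ r.len then
            { arr := r.arr + 1, srv := r.srv, len := ⟨r.len + 1, by omega⟩,
              adm := r.adm + 1, dep := r.dep }
            else { r with arr := r.arr + 1 } := by
          intro τ u
          simp only [arrive, hC, true_and]
          split_ifs <;> rfl
        simp_rw [this]
        exact Measurable.ite (measurableSet_lt (hW.mark_measurable r.arr) hprob)
          measurable_const measurable_const
      · simp only [arrive, hC, false_and, dite_false]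
        exact measurable_const
    have hrec : (fun ω => Q.record π W ω (n + 1)) = fun ω => step (Q.record π W ω n, ω) := by
      funext ω
      simp only [record, step]
    rw [hrec]
    exact hstep.comp (ih.prodMk measurable_id)

theorem IsDriving.measurable_recordAt (hW : Q.IsDriving W P) :
    Measurable fun p : Set.Icc 0 Q.T × Ω => Q.recordAt π W p.1 p.2 := by
  have h : Measurable fun q : ℕ × Ω => Q.record π W q.2 q.1 :=
    measurable_from_prod_countable_right fun n => hW.measurable_record π n
  exact h.comp ((hW.arrivals.measurable_uncurry.add hW.services.measurable_uncurry).prodMk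
    measurable_snd)

theorem IsDriving.measurable_X (hW : Q.IsDriving W P) :
    Measurable fun p : Set.Icc 0 Q.T × Ω => Q.X π W p.1 p.2 :=
  (Measurable.of_discrete (f := QueueRecord.len)).comp (hW.measurable_recordAt π)

theorem IsDriving.measurable_A (hW : Q.IsDriving W P) :
    Measurable fun p : Set.Icc 0 Q.T × Ω => Q.A π W p.1 p.2 :=
  (Measurable.of_discrete (f := QueueRecord.adm)).comp (hW.measurable_recordAt π)

theorem IsDriving.tendsto_X_XLeft (hW : Q.IsDriving W P) {t : ℝ} (ht0 : 0 < t) (htT : t ≤ Q.T)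
    (ω : Ω) : Tendsto (fun s => Q.X π W s ω) (𝓝[<] t) (𝓝 (Q.XLeft π W t ω)) := by
  obtain ⟨a, ha⟩ := (hW.arrivals.mono ω).exists_eventually_eq_nhdsLT ht0 htT
  obtain ⟨b, hb⟩ := (hW.services.mono ω).exists_eventually_eq_nhdsLT ht0 htT
  have h : Tendsto (fun s => Q.X π W s ω) (𝓝[<] t) (𝓝 (Q.record π W ω (a + b)).len) := by
    refine tendsto_const_nhds.congr' ?_
    filter_upwards [ha, hb] with s hsa hsb
    simp only [X, recordAt, hsa, hsb]
  have hl : Q.XLeft π W t ω = (Q.record π W ω (a + b)).len :=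
    leftLim_eq_of_tendsto h
  rwa [hl]

/-- The left limits of the queue length, with the value at time `0` replaced by `X_0` because
the left limit there sees times before the horizon. -/
theorem IsDriving.measurable_XLeft (hW : Q.IsDriving W P) :
    Measurable fun p : Set.Icc 0 Q.T × Ω =>
      if 0 < (p.1 : ℝ) then Q.XLeft π W p.1 p.2 else Q.X π W p.1 p.2 := by
  -- The left limit is approached along `t * (1 - 1 / (n + 1))`, which stays in the horizon.
  have hc : ∀ n : ℕ, (0 : ℝ) ≤ 1 - 1 / ((n : ℝ) + 1) ∧ 1 - 1 / ((n : ℝ) + 1) < 1 := by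
    intro n
    have h1 : (0 : ℝ) < 1 / ((n : ℝ) + 1) := by positivity
    have h2 : 1 / ((n : ℝ) + 1) ≤ 1 := by
      rw [div_le_one (by positivity)]
      linarith [(Nat.cast_nonneg n : (0 : ℝ) ≤ n)]
    constructor <;> linarith
  have hmem : ∀ (n : ℕ) (t : Set.Icc 0 Q.T), (t : ℝ) * (1 - 1 / ((n : ℝ) + 1)) ∈ Set.Icc 0 Q.T :=
    fun n t => ⟨mul_nonneg t.2.1 (hc n).1,
      (mul_le_of_le_one_right t.2.1 (hc n).2.le).trans t.2.2⟩
  have hmeas : ∀ n : ℕ, Measurable fun p : Set.Icc 0 Q.T × Ω =>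
      Q.X π W ((p.1 : ℝ) * (1 - 1 / ((n : ℝ) + 1))) p.2 := fun n =>
    (hW.measurable_X π).comp
      (f := fun p : Set.Icc 0 Q.T × Ω => ((⟨_, hmem n p.1⟩ : Set.Icc 0 Q.T), p.2))
      ((((measurable_subtype_coe.comp measurable_fst).mul_const _).subtype_mk).prodMk
        measurable_snd)
  refine measurable_of_tendsto_metrizable hmeas (tendsto_pi_nhds.2 fun p => ?_)
  by_cases hp : 0 < (p.1 : ℝ)
  · simp only [hp, if_true]
    refine (hW.tendsto_X_XLeft π hp p.1.2.2 p.2).comp (tendsto_nhdsWithin_iff.2 ⟨?_, ?_⟩)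
    · have h := (tendsto_one_div_add_atTop_nhds_zero_nat (𝕜 := ℝ)).const_sub 1
      simpa using h.const_mul (p.1 : ℝ)
    · exact Eventually.of_forall fun n => mul_lt_of_lt_one_right hp (hc n).2
  · have h0 : (p.1 : ℝ) = 0 := le_antisymm (not_lt.1 hp) p.1.2.1
    simp [h0]

/-! ### The reward-to-go -/

theorem isFiniteMeasure_comap_Icc (T : ℝ) :
    IsFiniteMeasure ((volume : Measure ℝ).comap (Subtype.val : Set.Icc 0 T → ℝ)) := by
  refine ⟨?_⟩
  rw [comap_subtype_coe_apply measurableSet_Icc, Set.image_univ, Subtype.range_coe]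
  exact measure_Icc_lt_top

/-- A jointly measurable running reward, prescribed at the times `s > 0` only, accumulates to a
jointly measurable process. -/
theorem measurable_intervalIntegral_to_horizon {T : ℝ} {f : ℝ → Ω → ℝ}
    (hf : Measurable fun q : Set.Icc 0 T × Ω => if 0 < (q.1 : ℝ) then f q.1 q.2 else 0) :
    Measurable fun p : Set.Icc 0 T × Ω => ∫ s in (p.1 : ℝ)..T, f s p.2 := by
  have heq : (fun p : Set.Icc 0 T × Ω => ∫ s in (p.1 : ℝ)..T, f s p.2)
      = fun p => ∫ s : Set.Icc 0 T, (if p.1 < s then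
          (if 0 < (s : ℝ) then f s p.2 else 0) else 0) ∂(volume.comap Subtype.val) := by
    funext p
    have h1 : Set.Ioc (p.1 : ℝ) T = Set.Icc 0 T ∩ Set.Ioc (p.1 : ℝ) T := by
      rw [Set.inter_eq_right.2]
      exact fun s hs => ⟨p.1.2.1.trans hs.1.le, hs.2⟩
    rw [intervalIntegral.integral_of_le p.1.2.2, h1, ← setIntegral_indicator measurableSet_Ioc,
      ← integral_subtype_comap measurableSet_Icc]
    refine integral_congr_ae (ae_of_all _ fun s => ?_)
    simp only
    by_cases hs : p.1 < s
    · have h0 : (0 : ℝ) < s := p.1.2.1.trans_lt hs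
      rw [if_pos hs, if_pos h0, Set.indicator_of_mem]
      exact ⟨hs, s.2.2⟩
    · rw [if_neg hs, Set.indicator_of_notMem]
      exact fun h => hs h.1
  rw [heq]
  have hF : Measurable fun z : (Set.Icc 0 T × Ω) × Set.Icc 0 T =>
      if z.1.1 < z.2 then (if 0 < (z.2 : ℝ) then f z.2 z.1.2 else 0) else 0 :=
    Measurable.ite (measurableSet_lt (by fun_prop) (by fun_prop))
      (hf.comp (f := fun z : (Set.Icc 0 T × Ω) × Set.Icc 0 T => (z.2, z.1.2)) (by fun_prop))
      measurable_const
  have := isFiniteMeasure_comap_Icc T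
  exact (hF.stronglyMeasurable.integral_prod_right' (ν := volume.comap Subtype.val)).measurable

theorem Policy.measurable_entropy (π : Q.Policy) :
    Measurable fun q : Set.Icc 0 Q.T × Q.State => Q.entropy π q.1 q.2 :=
  measurable_from_prod_countable_left fun x =>
    Real.binEntropy_continuous.measurable.comp (π.measurable x)

theorem IsDriving.measurable_rewardToGo (hW : Q.IsDriving W P) :
    Measurable fun p : Set.Icc 0 Q.T × Ω => Q.rewardToGo π W p.1 p.2 := by
  have hT : Measurable fun p : Set.Icc 0 Q.T × Ω =>
      ((⟨Q.T, Q.T_pos.le, le_rfl⟩ : Set.Icc 0 Q.T), p.2) := by fun_prop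
  have hcast : Measurable fun x : Q.State => ((x : ℕ) : ℝ) := measurable_of_finite _
  have hnat : Measurable fun n : ℕ => (n : ℝ) := .of_discrete
  have hpos : MeasurableSet {q : Set.Icc 0 Q.T × Ω | 0 < (q.1 : ℝ)} :=
    measurableSet_lt measurable_const (by fun_prop)
  have hlen : Measurable fun p : Set.Icc 0 Q.T × Ω =>
      ∫ s in (p.1 : ℝ)..Q.T, ((Q.XLeft π W s p.2 : ℕ) : ℝ) := by
    refine measurable_intervalIntegral_to_horizon
      (f := fun s ω => ((Q.XLeft π W s ω : ℕ) : ℝ)) ?_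
    have h : Measurable fun q : Set.Icc 0 Q.T × Ω => if 0 < (q.1 : ℝ) then
        (((if 0 < (q.1 : ℝ) then Q.XLeft π W q.1 q.2 else Q.X π W q.1 q.2 : Q.State) : ℕ) : ℝ)
        else 0 := Measurable.ite hpos (hcast.comp (hW.measurable_XLeft π)) measurable_const
    convert h using 2 with q
    split_ifs <;> simp
  have hent : Measurable fun p : Set.Icc 0 Q.T × Ω =>
      ∫ s in (p.1 : ℝ)..Q.T, Q.entropy π s (Q.XLeft π W s p.2) := by
    refine measurable_intervalIntegral_to_horizon
      (f := fun s ω => Q.entropy π s (Q.XLeft π W s ω)) ?_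
    have h : Measurable fun q : Set.Icc 0 Q.T × Ω => if 0 < (q.1 : ℝ) then
        Q.entropy π q.1 (if 0 < (q.1 : ℝ) then Q.XLeft π W q.1 q.2 else Q.X π W q.1 q.2)
        else 0 := Measurable.ite hpos
      (π.measurable_entropy.comp (measurable_fst.prodMk (hW.measurable_XLeft π)))
      measurable_const
    convert h using 2 with q
    split_ifs <;> simp
  exact (((((hnat.comp ((hW.measurable_A π).comp hT)).sub
    (hnat.comp (hW.measurable_A π))).const_mul _).sub (hlen.const_mul _)).sub
    ((hcast.comp ((hW.measurable_X π).comp hT)).const_mul _)).add (hent.const_mul _)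

theorem IsDriving.A_le (hW : Q.IsDriving W P) {t : ℝ} (ht : t ∈ Set.Icc 0 Q.T) (ω : Ω) :
    Q.A π W t ω ≤ W.arrivals Q.T ω + W.services Q.T ω :=
  (Q.record_adm_le π W ω _).trans (add_le_add
    (hW.arrivals.mono ω ht ⟨Q.T_pos.le, le_rfl⟩ ht.2)
    (hW.services.mono ω ht ⟨Q.T_pos.le, le_rfl⟩ ht.2))

/-- The reward-to-go is bounded, uniformly in time, by an affine function of the total number of
events: the queue length is at most `C` and the entropy at most `log 2`. -/
theorem IsDriving.abs_rewardToGo_le (hW : Q.IsDriving W P) {t : ℝ} (ht : t ∈ Set.Icc 0 Q.T)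
    (ω : Ω) : |Q.rewardToGo π W t ω| ≤
      Q.K₁ * ((W.arrivals Q.T ω : ℝ) + W.services Q.T ω)
        + (Q.K₂ * (Q.C * Q.T) + Q.K₃ * Q.C + Q.γ * (Real.log 2 * Q.T)) := by
  have hTI : Q.T ∈ Set.Icc 0 Q.T := ⟨Q.T_pos.le, le_rfl⟩
  have hC : ∀ x : Q.State, ((x : ℕ) : ℝ) ≤ Q.C := fun x => by
    exact_mod_cast Nat.lt_succ_iff.1 x.2
  have hAT : (Q.A π W Q.T ω : ℝ) ≤ (W.arrivals Q.T ω : ℝ) + W.services Q.T ω := by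
    exact_mod_cast hW.A_le π hTI ω
  have hAt : (Q.A π W t ω : ℝ) ≤ (W.arrivals Q.T ω : ℝ) + W.services Q.T ω := by
    exact_mod_cast hW.A_le π ht ω
  have hint : ∀ (c : ℝ) (f : ℝ → ℝ), 0 ≤ c → (∀ s ∈ Set.Ioc t Q.T, |f s| ≤ c) →
      |∫ s in t..Q.T, f s| ≤ c * Q.T := by
    intro c f hc hf
    have h := intervalIntegral.norm_integral_le_of_norm_le_const (f := f) (C := c)
      (a := t) (b := Q.T) (by rwa [Set.uIoc_of_le ht.2])
    rw [Real.norm_eq_abs, abs_of_nonneg (sub_nonneg.2 ht.2)] at h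
    exact h.trans (mul_le_mul_of_nonneg_left (by linarith [ht.1]) hc)
  have hI₁ := hint Q.C (fun s => ((Q.XLeft π W s ω : ℕ) : ℝ)) (Nat.cast_nonneg _)
    fun s _ => by rw [abs_of_nonneg (Nat.cast_nonneg _)]; exact hC _
  have hI₂ := hint (Real.log 2) (fun s => Q.entropy π s (Q.XLeft π W s ω))
    (Real.log_nonneg one_le_two) fun s hs => by
      have hp := π.prob_mem s ⟨ht.1.trans hs.1.le, hs.2⟩ (Q.XLeft π W s ω)
      rw [entropy, abs_of_nonneg (Real.binEntropy_nonneg hp.1 hp.2)]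
      exact Real.binEntropy_le_log_two
  have h₁ : |(Q.A π W Q.T ω : ℝ) - (Q.A π W t ω : ℝ)|
      ≤ (W.arrivals Q.T ω : ℝ) + W.services Q.T ω := by
    rw [abs_le]
    constructor <;>
      linarith [(Nat.cast_nonneg (Q.A π W Q.T ω) : (0 : ℝ) ≤ _),
        (Nat.cast_nonneg (Q.A π W t ω) : (0 : ℝ) ≤ _)]
  have h₃ : |((Q.X π W Q.T ω : ℕ) : ℝ)| ≤ Q.C := by
    rw [abs_of_nonneg (Nat.cast_nonneg _)]
    exact hC _
  have m₁ := mul_le_mul_of_nonneg_left h₁ Q.K₁_pos.le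
  have m₂ := mul_le_mul_of_nonneg_left hI₁ Q.K₂_pos.le
  have m₃ := mul_le_mul_of_nonneg_left h₃ Q.K₃_pos.le
  have m₄ := mul_le_mul_of_nonneg_left hI₂ Q.γ_nonneg
  rw [← abs_of_nonneg Q.K₁_pos.le, ← abs_mul, abs_of_nonneg Q.K₁_pos.le] at m₁
  rw [← abs_of_nonneg Q.K₂_pos.le, ← abs_mul, abs_of_nonneg Q.K₂_pos.le] at m₂
  rw [← abs_of_nonneg Q.K₃_pos.le, ← abs_mul, abs_of_nonneg Q.K₃_pos.le] at m₃
  rw [← abs_of_nonneg Q.γ_nonneg, ← abs_mul, abs_of_nonneg Q.γ_nonneg] at m₄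
  rw [rewardToGo]
  rw [abs_le] at m₁ m₂ m₃ m₄ ⊢
  constructor <;> linarith

theorem IsDriving.measurable_J [IsFiniteMeasure P] (hW : Q.IsDriving W P) (x : Q.State) :
    Measurable fun t : Set.Icc 0 Q.T => Q.J P π W t x := by
  have hms : MeasurableSet {p : Set.Icc 0 Q.T × Ω | Q.X π W p.1 p.2 = x} :=
    hW.measurable_X π (measurableSet_singleton x)
  have h1 : Measurable fun t : Set.Icc 0 Q.T => P {ω | Q.X π W t ω = x} :=
    measurable_measure_prodMk_left hms
  have h2 : Measurable fun t : Set.Icc 0 Q.T =>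
      ∫ ω, {p : Set.Icc 0 Q.T × Ω | Q.X π W p.1 p.2 = x}.indicator
        (fun p => Q.rewardToGo π W p.1 p.2) (t, ω) ∂P :=
    ((hW.measurable_rewardToGo π).indicator hms).stronglyMeasurable.integral_prod_right'.measurable
  convert h1.inv.ennreal_toReal.mul h2 using 2 with t
  have hmt : MeasurableSet {ω | Q.X π W t ω = x} := measurable_prodMk_left hms
  rw [J, ProbabilityTheory.cond, integral_smul_measure, smul_eq_mul,
    ← integral_indicator hmt]
  rfl

/-! ### The bias-variance decomposition of the Monte Carlo loss -/

/-- The irreducible part of the Monte Carlo loss: half the expected time integral of the squared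
deviation of the reward-to-go from its conditional mean. -/
noncomputable def residualLoss (Q : AdmissionQueue) (P : Measure Ω) (π : Q.Policy)
    (W : Noise Ω) : ℝ≥0∞ :=
  2⁻¹ * ∫⁻ t : Set.Icc 0 Q.T, (∫⁻ ω,
    ENNReal.ofReal ((Q.rewardToGo π W t ω - Q.J P π W t (Q.X π W t ω)) ^ 2) ∂P)
      ∂(volume.comap Subtype.val)

theorem lintegral_lintegral_Icc_swap [SFinite P] {T : ℝ} {f : ℝ → Ω → ℝ≥0∞}
    (hf : Measurable fun p : Set.Icc 0 T × Ω => f p.1 p.2) :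
    ∫⁻ ω, (∫⁻ t in Set.Icc 0 T, f t ω) ∂P
      = ∫⁻ t : Set.Icc 0 T, (∫⁻ ω, f t ω ∂P) ∂(volume.comap Subtype.val) := by
  have := isFiniteMeasure_comap_Icc T
  simp_rw [← lintegral_subtype_comap measurableSet_Icc]
  rw [lintegral_lintegral_swap]
  exact (hf.comp measurable_swap).aemeasurable

theorem measurable_comp_uncurry {T : ℝ} {S : Type*} [Countable S] [MeasurableSpace S]
    [MeasurableSingletonClass S] {v : ℝ → S → ℝ}
    (hv : ∀ x, Measurable fun t : Set.Icc 0 T => v t x) {Y : Set.Icc 0 T × Ω → S}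
    (hY : Measurable Y) : Measurable fun p : Set.Icc 0 T × Ω => v p.1 (Y p) :=
  (measurable_from_prod_countable_left (f := fun q : Set.Icc 0 T × S => v q.1 q.2) hv).comp
    (measurable_fst.prodMk hY)

theorem IsDriving.memLp_bound [IsFiniteMeasure P] (hW : Q.IsDriving W P) (c : ℝ) :
    MemLp (fun ω => Q.K₁ * ((W.arrivals Q.T ω : ℝ) + W.services Q.T ω) + c) 2 P :=
  (((hW.arrivals.memLp_two Q.T_pos.le).add (hW.services.memLp_two Q.T_pos.le)).const_mul _).add
    (memLp_const c)

theorem IsDriving.memLp_rewardToGo [IsFiniteMeasure P] (hW : Q.IsDriving W P)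
    (t : Set.Icc 0 Q.T) : MemLp (fun ω => Q.rewardToGo π W t ω) 2 P :=
  (hW.memLp_bound _).mono'
    ((hW.measurable_rewardToGo π).comp measurable_prodMk_left).aestronglyMeasurable
    (ae_of_all _ fun ω => hW.abs_rewardToGo_le π t.2 ω)

theorem IsDriving.mcLoss_eq_residualLoss_add_msve [IsFiniteMeasure P] (hW : Q.IsDriving W P)
    {v : ℝ → Q.State → ℝ} (hv : ∀ x, Measurable fun t : Set.Icc 0 Q.T => v t x) :
    Q.mcLoss P π W v = Q.residualLoss P π W + Q.msve P π W v := by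
  have hG := hW.measurable_rewardToGo π
  have hX := hW.measurable_X π
  have hJX := measurable_comp_uncurry (fun x => hW.measurable_J π x) hX
  have hvX := measurable_comp_uncurry hv hX
  rw [mcLoss, msve, residualLoss,
    lintegral_lintegral_Icc_swap ((hG.sub hvX).pow_const 2).ennreal_ofReal,
    lintegral_lintegral_Icc_swap ((hJX.sub hvX).abs.pow_const 2).ennreal_ofReal,
    ← mul_add, ← lintegral_add_left]
  · congr 1
    exact lintegral_congr fun t => lintegral_ofReal_sq_eq_add
      (hX.comp measurable_prodMk_left) (hW.memLp_rewardToGo π t) (v t)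
  · exact ((hG.sub hJX).pow_const 2).ennreal_ofReal.lintegral_prod_right'

theorem IsDriving.residualLoss_ne_top [IsFiniteMeasure P] (hW : Q.IsDriving W P) :
    Q.residualLoss P π W ≠ ∞ := by
  have := isFiniteMeasure_comap_Icc Q.T
  set c := Q.K₂ * (Q.C * Q.T) + Q.K₃ * Q.C + Q.γ * (Real.log 2 * Q.T)
  set B : ℝ≥0∞ := ∫⁻ ω, ENNReal.ofReal
    ((Q.K₁ * ((W.arrivals Q.T ω : ℝ) + W.services Q.T ω) + c) ^ 2) ∂P with hB
  have hBtop : B ≠ ∞ := by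
    rw [hB, ← ofReal_integral_eq_lintegral_ofReal (hW.memLp_bound c).integrable_sq
      (ae_of_all _ fun _ => sq_nonneg _)]
    exact ENNReal.ofReal_ne_top
  have hle : ∀ t : Set.Icc 0 Q.T, ∫⁻ ω,
      ENNReal.ofReal ((Q.rewardToGo π W t ω - Q.J P π W t (Q.X π W t ω)) ^ 2) ∂P ≤ B := by
    intro t
    -- Subtracting the conditional mean does not increase the second moment.
    have h := lintegral_ofReal_sq_eq_add (P := P) ((hW.measurable_X π).comp
      (measurable_prodMk_left (x := t))) (hW.memLp_rewardToGo π t) (fun _ => 0)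
    refine (le_self_add.trans h.ge).trans (lintegral_mono fun ω => ENNReal.ofReal_le_ofReal ?_)
    rw [sub_zero]
    exact sq_le_sq' (abs_le.1 (hW.abs_rewardToGo_le π t.2 ω)).1
      (abs_le.1 (hW.abs_rewardToGo_le π t.2 ω)).2
  refine ENNReal.mul_ne_top (by simp) (ne_top_of_le_ne_top ?_ (lintegral_mono hle))
  rw [lintegral_const]
  exact ENNReal.mul_ne_top hBtop (measure_ne_top _ _)

end AdmissionQueue

theorem argminSet_const_add {Θ : Type*} {f g : Θ → ℝ≥0∞} {c : ℝ≥0∞} (hc : c ≠ ∞)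
    (h : ∀ θ, f θ = c + g θ) : argminSet f = argminSet g := by
  ext θ
  simp only [argminSet, h, ENNReal.add_le_add_iff_left hc]

theorem mainTheorem7 {Ω : Type*} [MeasurableSpace Ω] (P : Measure Ω) [IsProbabilityMeasure P]
    (Q : AdmissionQueue) (π : Q.Policy) (W : AdmissionQueue.Noise Ω) (hW : Q.IsDriving W P)
    {Θ : Type*} (Jθ : Θ → ℝ → Q.State → ℝ)
    (hJθ : ∀ θ x, Measurable fun t : Set.Icc (0 : ℝ) Q.T => Jθ θ t x) :
    argminSet (fun θ => Q.mcLoss P π W (Jθ θ)) = argminSet (fun θ => Q.msve P π W (Jθ θ)) :=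
  argminSet_const_add (hW.residualLoss_ne_top π)
    fun θ => hW.mcLoss_eq_residualLoss_add_msve π (hJθ θ)
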